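/- Let $d\ge 2$. A $d$-polytope is the convex hull of finitely many points of $\mathbb{R}^d$ that affinely span $\mathbb{R}^d$; its isometry group $\mathrm{Iso}(P)$ is the group of all isometries of $\mathbb{R}^d$ that map $P$ onto itself, and $P$ is vertex-transitive if $\mathrm{Iso}(P)$ acts transitively on its vertices. Let $G$ be the isometry group of a vertex-transitive $d$-polytope in $\mathbb{R}^d$, let $r=|G|$ (so that $3\le r<\infty$), and let $N=(r-2)(d+1)+2$. Then there is a dense open subset $U\subseteq(\mathbb{R}^d)^N$ whose complement has Lebesgue measure zero such that for every $(x_1,\dots,x_N)\in U$ there are a vertex-transitive $d$-polytope $P\subset\mathbb{R}^d$ with exactly $r$ vertices, a partition $A_1,\dots,A_r$ of $\{1,\dots,N\}$, and points $y_i\in\mathrm{conv}\{x_j: j\in A_i\}$ for $1\le i\le r$, such that $\{y_1,\dots,y_r\}$ is the vertex set of $P$, and such that $\mathrm{Iso}(P)=G$ up to a translation, that is, $\mathrm{Iso}(P)=\tau G\tau^{-1}$ for some translation $\tau$ of $\mathbb{R}^d$. -/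

import Mathlib

/-- The isometry group of a set `P` in `ℝ^d`: all isometries of `ℝ^d` onto itself that map `P`
onto `P`. -/
def isoGroup {d : ℕ} (P : Set (EuclideanSpace ℝ (Fin d))) :
    Subgroup (EuclideanSpace ℝ (Fin d) ≃ᵢ EuclideanSpace ℝ (Fin d)) where
  carrier := {φ | φ '' P = P}
  one_mem' := by
    change (fun x => x) '' P = P
    exact Set.image_id' P
  mul_mem' := by
    intro φ ψ hφ hψ
    change (fun x => φ (ψ x)) '' P = P
    rw [← Set.image_image, show ψ '' P = P from hψ]
    exact hφ
  inv_mem' := by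
    intro φ hφ
    change φ.symm '' P = P
    have h : φ '' P = P := hφ
    conv_lhs => rw [← h]
    rw [Set.image_image]
    simp

/-- A `d`-polytope in `ℝ^d`: the convex hull of finitely many points, of full dimension `d`. -/
def IsFullPolytope {d : ℕ} (P : Set (EuclideanSpace ℝ (Fin d))) : Prop :=
  (∃ S : Finset (EuclideanSpace ℝ (Fin d)),
    P = convexHull ℝ (S : Set (EuclideanSpace ℝ (Fin d)))) ∧
  affineSpan ℝ P = ⊤

/-- A vertex-transitive `d`-polytope in `ℝ^d`: any vertex (extreme point) is carried to any other
one by an isometry of the polytope. -/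
def IsVertexTransitivePolytope {d : ℕ} (P : Set (EuclideanSpace ℝ (Fin d))) : Prop :=
  IsFullPolytope P ∧
  ∀ v ∈ P.extremePoints ℝ, ∀ w ∈ P.extremePoints ℝ, ∃ φ ∈ isoGroup P, φ v = w

/-- The points `x 1, …, x N` can be `P`-partitioned, where `P` is a polytope with exactly `r`
vertices: they can be divided into `r` classes `A 1, …, A r` such that points
`y i ∈ conv (A i)`, one from each class, are the `r` (distinct) vertices of `P`. -/
def CanBePartitioned {d N : ℕ} (r : ℕ) (P : Set (EuclideanSpace ℝ (Fin d)))
    (x : Fin N → EuclideanSpace ℝ (Fin d)) : Prop :=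
  ∃ A : Fin r → Set (Fin N),
    Pairwise (fun i j => Disjoint (A i) (A j)) ∧ (⋃ i, A i) = Set.univ ∧
    ∃ y : Fin r → EuclideanSpace ℝ (Fin d),
      (∀ i, y i ∈ convexHull ℝ (x '' A i)) ∧
      Function.Injective y ∧ Set.range y = P.extremePoints ℝ

/-- A property holds for a generic set of `N` points in `ℝ^d` if it holds for all `N`-tuples in
some dense open subset of `(ℝ^d)^N` with full Lebesgue measure. -/
def HoldsForGeneric {d N : ℕ} (p : (Fin N → EuclideanSpace ℝ (Fin d)) → Prop) : Prop :=
  ∃ U : Set (Fin N → EuclideanSpace ℝ (Fin d)),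
    IsOpen U ∧ Dense U ∧ MeasureTheory.volume Uᶜ = 0 ∧ ∀ x ∈ U, p x

/-- The subgroups `H` and `G` of the isometry group of `ℝ^d` agree up to moving the origin:
`H = τ G τ⁻¹` for the translation `τ : x ↦ c + x` by some vector `c`. -/
def EqUpToTranslation {d : ℕ}
    (H G : Subgroup (EuclideanSpace ℝ (Fin d) ≃ᵢ EuclideanSpace ℝ (Fin d))) : Prop :=
  ∃ c : EuclideanSpace ℝ (Fin d),
    H = G.map (MulAut.conj (IsometryEquiv.addLeft c)).toMonoidHom

/-! After the centroid of the given polytope is moved to the origin, `G` becomes a finite linear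
group `H` of order `r` with no nonzero fixed vector. The task is then to split the points into
classes indexed by `H` with convex combinations `c + h v`, and to take the hull of this orbit as
`P`.

Existence of such a partition, for every `x`, is Sarkaria's tensor trick. The tuples `(c + h v, s)`
indexed by `H` form a subspace of `(ℝ^d × ℝ)^H` of dimension `2d + 1`. Its quotient has dimension
`r(d+1) - 2d - 1 = N - 1`, so colourful Carathéodory applies with `N` colours
(`exists_partition_orbit`).

The orbit of an arbitrary `v` may be degenerate or too symmetric. For a generic seed it spans, is
free, and has no accidental equalities of inner products, so any symmetry of it permutes `H` in a
way that preserves the Gram matrices of all orbits. Comparison with the orbit of a vertex `v₀` of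
the original polytope, whose symmetries all lie in `H`, shows that this permutation is a left
translation (`exists_perm_eq_mul_left`).

Bad seeds form a closed null set `B`. The same count makes the number of parameters of a
configuration with prescribed orbit equal to `Nd`, so configurations admitting a bad seed are a
differentiable image of a null set, hence null (`addHaar_orbitPartitionSet`). They form a closed set
because the weights range over a compact set. `U` is the complement. -/

/-! ### Colourful Carathéodory and Sarkaria's linearisation -/

open Module in
/-- **Colorful Carathéodory theorem**. -/
theorem exists_transversal_zero_mem_convexHull {W : Type*} [NormedAddCommGroup W]
    [InnerProductSpace ℝ W] [FiniteDimensional ℝ W] {ι κ : Type*} [Fintype ι] [Finite κ]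
    (hcard : finrank ℝ W < Fintype.card ι) (p : ι → κ → W)
    (hp : ∀ i, (0 : W) ∈ convexHull ℝ (Set.range (p i))) :
    ∃ f : ι → κ, (0 : W) ∈ convexHull ℝ (Set.range fun i => p i (f i)) := by
  classical
  have hι : Nonempty ι := Fintype.card_pos_iff.1 (by omega)
  have hκ : Nonempty κ := by
    obtain ⟨i⟩ := hι
    have h : (convexHull ℝ (Set.range (p i))).Nonempty := ⟨0, hp i⟩
    rw [convexHull_nonempty_iff, Set.range_nonempty_iff_nonempty] at h
    exact h
  have hmin : ∀ f : ι → κ, ∃ z ∈ convexHull ℝ (Set.range fun i => p i (f i)),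
      ∀ w ∈ convexHull ℝ (Set.range fun i => p i (f i)), ‖z‖ ≤ ‖w‖ := by
    intro f
    have hne : (convexHull ℝ (Set.range fun i => p i (f i))).Nonempty := by
      rw [convexHull_nonempty_iff]
      exact Set.range_nonempty _
    have hcpt : IsCompact (convexHull ℝ (Set.range fun i => p i (f i))) :=
      (Set.finite_range fun i => p i (f i)).isCompact_convexHull ℝ
    obtain ⟨z, hz, h⟩ := hcpt.exists_isMinOn hne continuous_norm.continuousOn
    exact ⟨z, hz, fun w hw => h hw⟩
  choose z hz hzmin using hmin
  -- Take the transversal whose hull is closest to the origin; if it misses the origin, exchanging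
  -- one colour will give a contradiction.
  obtain ⟨f, hf⟩ := Finite.exists_min fun f => ‖z f‖
  refine ⟨f, ?_⟩
  by_contra h0
  have hz0 : z f ≠ 0 := fun h => h0 (h ▸ hz f)
  have hpos : 0 < ‖z f‖ ^ 2 := by positivity
  -- Variational characterisation of the point of `K` nearest to the origin.
  have key : ∀ K : Set W, Convex ℝ K → z f ∈ K → (∀ w ∈ K, ‖z f‖ ≤ ‖w‖) →
      ∀ w ∈ K, ‖z f‖ ^ 2 ≤ inner ℝ (z f) w := by
    intro K hK hzK hm w hw
    have hbdd : BddBelow (Set.range fun w : K => ‖(0 : W) - w‖) :=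
      ⟨0, by rintro _ ⟨w, rfl⟩; exact norm_nonneg _⟩
    have : Nonempty K := ⟨⟨_, hzK⟩⟩
    have h1 : ‖(0 : W) - z f‖ = ⨅ w : K, ‖(0 : W) - w‖ := by
      refine le_antisymm (le_ciInf fun w => ?_) (ciInf_le hbdd ⟨z f, hzK⟩)
      simpa using hm w w.2
    have h2 := (norm_eq_iInf_iff_real_inner_le_zero hK hzK).1 h1 w hw
    rw [zero_sub, inner_neg_left, inner_sub_right, real_inner_self_eq_norm_sq] at h2
    linarith
  have hge := key _ (convex_convexHull ℝ _) (hz f) (hzmin f)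
  obtain ⟨ι', _, q, w, hq, hind, hwpos, hwsum, hwz⟩ :=
    eq_pos_convex_span_of_mem_convexHull (hz f)
  have hqeq : ∀ k, inner ℝ (z f) (q k) = ‖z f‖ ^ 2 := by
    have h1 : ∑ k, w k * (inner ℝ (z f) (q k) - ‖z f‖ ^ 2) = 0 := by
      simp only [mul_sub, Finset.sum_sub_distrib, ← Finset.sum_mul, hwsum, one_mul]
      have : inner ℝ (z f) (∑ k, w k • q k) = ‖z f‖ ^ 2 := by
        rw [hwz, real_inner_self_eq_norm_sq]
      rw [inner_sum] at this
      simp only [inner_smul_right] at this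
      rw [this, sub_self]
    intro k
    have h2 := (Finset.sum_eq_zero_iff_of_nonneg fun k _ => mul_nonneg (hwpos k).le
      (sub_nonneg.2 (hge _ (subset_convexHull ℝ _ (hq ⟨k, rfl⟩))))).1 h1 k (Finset.mem_univ k)
    rcases mul_eq_zero.1 h2 with h | h
    · exact absurd h (hwpos k).ne'
    · linarith
  -- Affinely independent points on a hyperplane missing the origin are linearly independent. There
  -- are thus at most `finrank ℝ W` of them, and some colour `i₀` is not used.
  have hlin : LinearIndependent ℝ q := by
    rw [Fintype.linearIndependent_iff]
    intro g hg
    have h1 : ∑ k, g k = 0 := by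
      have h2 : inner ℝ (z f) (∑ k, g k • q k) = 0 := by rw [hg, inner_zero_right]
      rw [inner_sum] at h2
      simp only [inner_smul_right, hqeq, ← Finset.sum_mul] at h2
      exact (mul_eq_zero.1 h2).resolve_right hpos.ne'
    intro k
    exact (affineIndependent_iff.1 hind) Finset.univ g h1 hg k (Finset.mem_univ k)
  choose i hi using fun k => hq ⟨k, rfl⟩
  obtain ⟨i₀, hi₀⟩ : ∃ i₀, ∀ k, i k ≠ i₀ := by
    by_contra! h
    have h1 := Fintype.card_le_of_surjective i h
    have h2 := hlin.fintype_card_le_finrank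
    omega
  obtain ⟨k₀, hk₀⟩ : ∃ k₀, inner ℝ (z f) (p i₀ k₀) ≤ 0 := by
    by_contra! h
    have h1 : convexHull ℝ (Set.range (p i₀)) ⊆ {w | 0 < inner ℝ (z f) w} := by
      refine convexHull_min ?_ (convex_halfSpace_gt
        (innerₗ W (z f)).isLinear 0)
      rintro _ ⟨k, rfl⟩
      exact h k
    simpa using h1 (hp i₀)
  -- The new hull still contains `z f`, which is still nearest to the origin by minimality of `f`,
  -- but it also contains a point with nonpositive inner product with `z f`.
  set f' := Function.update f i₀ k₀ with hf'
  have hqf' : ∀ k, q k ∈ convexHull ℝ (Set.range fun i => p i (f' i)) := by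
    intro k
    refine subset_convexHull ℝ _ ⟨i k, ?_⟩
    simp only [hf', Function.update_of_ne (hi₀ k)]
    exact hi k
  have hzf' : z f ∈ convexHull ℝ (Set.range fun i => p i (f' i)) := by
    rw [← hwz]
    exact (convex_convexHull ℝ _).sum_mem (fun k _ => (hwpos k).le) hwsum fun k _ => hqf' k
  have := key _ (convex_convexHull ℝ _) hzf' (fun w hw => (hf f').trans (hzmin f' w hw)) (p i₀ k₀)
    (subset_convexHull ℝ _ ⟨i₀, by simp [hf']⟩)
  linarith

theorem exists_weights_of_mem_convexHull_range {W : Type*} [AddCommGroup W] [Module ℝ W]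
    {ι : Type*} [Fintype ι] {v : ι → W} {z : W} (hz : z ∈ convexHull ℝ (Set.range v)) :
    ∃ t : ι → ℝ, (∀ i, 0 ≤ t i) ∧ ∑ i, t i = 1 ∧ ∑ i, t i • v i = z := by
  classical
  have h : convexHull ℝ (Set.range v) ⊆ Fintype.linearCombination ℝ v '' stdSimplex ℝ ι := by
    refine convexHull_min ?_ ((convex_stdSimplex ℝ ι).linear_image _)
    rintro _ ⟨i, rfl⟩
    exact ⟨Pi.single i 1, single_mem_stdSimplex ℝ i, by simp⟩
  obtain ⟨t, ht, rfl⟩ := h hz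
  exact ⟨t, ht.1, ht.2, by simp [Fintype.linearCombination_apply]⟩

open Module in
/-- Sarkaria's linearisation of the Tverberg problem: a family of points can be partitioned so that
the tuple of weighted (homogenised) sums of the classes lies in a prescribed subspace `L` containing
the constant tuples, provided `L` is large enough. -/
theorem exists_partition_sum_mem {E : Type*} [AddCommGroup E] [Module ℝ E]
    [FiniteDimensional ℝ E] {ι κ : Type*} [Fintype ι] [Fintype κ] [DecidableEq κ] [Nonempty κ]
    (L : Submodule ℝ (κ → E × ℝ)) (hconst : ∀ u : E × ℝ, (fun _ => u) ∈ L)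
    (hcard : Fintype.card κ * (finrank ℝ E + 1) < Fintype.card ι + finrank ℝ L) (x : ι → E) :
    ∃ (f : ι → κ) (t : ι → ℝ), (∀ i, 0 ≤ t i) ∧ ∑ i, t i = 1 ∧
      (fun k => ∑ i with f i = k, t i • (x i, (1 : ℝ))) ∈ L := by
  have hV : finrank ℝ (κ → E × ℝ) = Fintype.card κ * (finrank ℝ E + 1) := by
    rw [finrank_pi_fintype]; simp
  have hq := L.finrank_quotient_add_finrank
  let φ : ((κ → E × ℝ) ⧸ L) ≃ₗ[ℝ] EuclideanSpace ℝ (Fin (finrank ℝ ((κ → E × ℝ) ⧸ L))) :=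
    LinearEquiv.ofFinrankEq _ _ (by simp)
  let ψ := φ.toLinearMap ∘ₗ L.mkQ
  have hψ : ∀ u, ψ u = 0 ↔ u ∈ L := by
    intro u
    simp [ψ]
  let p : ι → κ → EuclideanSpace ℝ (Fin (finrank ℝ ((κ → E × ℝ) ⧸ L))) :=
    fun i k => ψ (Pi.single k (x i, 1))
  obtain ⟨f, hf⟩ := exists_transversal_zero_mem_convexHull (ι := ι) (by simp; omega) p (by
    intro i
    -- The copies of `(x i, 1)` in all positions add up to a constant tuple, which dies modulo `L`;
    -- so the origin is the barycentre of each colour class.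
    have hc : ∑ k, ((Fintype.card κ : ℝ)⁻¹) • p i k = 0 := by
      simp only [p]
      rw [← Finset.smul_sum, ← map_sum, ← map_smul, hψ]
      refine L.smul_mem _ ?_
      rw [Finset.univ_sum_single fun _ : κ => ((x i, 1) : E × ℝ)]
      exact hconst _
    rw [← hc]
    refine (convex_convexHull ℝ _).sum_mem (fun k _ => by positivity) (by simp) fun k _ =>
      subset_convexHull ℝ _ ⟨k, rfl⟩)
  obtain ⟨t, ht0, ht1, ht⟩ := exists_weights_of_mem_convexHull_range hf
  refine ⟨f, t, ht0, ht1, ?_⟩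
  simp only [p, ← map_smul, ← map_sum] at ht
  rw [hψ] at ht
  convert ht using 1
  ext1 k
  rw [Finset.sum_apply, Finset.sum_filter]
  refine Finset.sum_congr rfl fun i _ => ?_
  by_cases h : f i = k
  · subst h; simp
  · simp [h]

-- Apply Sarkaria's linearisation to the range of `(c, v, s) ↦ (c + h v, s)`. The absence of fixed
-- vectors makes this map injective, and the last coordinate forces all classes to have equal total
-- weight, which can be normalised to one.
open Module in
theorem LinearIsometryEquiv.exists_partition_orbit {E : Type*} [NormedAddCommGroup E]
    [InnerProductSpace ℝ E] [FiniteDimensional ℝ E] (H : Subgroup (E ≃ₗᵢ[ℝ] E)) [Fintype H]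
    [DecidableEq H]
    (hfix : ∀ w : E, (∀ h ∈ H, h w = w) → w = 0) {ι : Type*} [Fintype ι]
    (hcard : Fintype.card H * (finrank ℝ E + 1) < Fintype.card ι + (2 * finrank ℝ E + 1))
    (x : ι → E) :
    ∃ (f : ι → H) (t : ι → ℝ), (∀ i, 0 ≤ t i) ∧ (∀ h, ∑ i with f i = h, t i = 1) ∧
      ∃ c v : E, ∀ h : H, ∑ i with f i = h, t i • x i = c + (h : E ≃ₗᵢ[ℝ] E) v := by
  let Φ : (E × E × ℝ) →ₗ[ℝ] (H → E × ℝ) :=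
    { toFun := fun u h => (u.1 + (h : E ≃ₗᵢ[ℝ] E) u.2.1, u.2.2)
      map_add' := fun u u' => by
        ext1 h; simp only [Prod.fst_add, Prod.snd_add, map_add, Pi.add_apply, Prod.mk_add_mk,
          Prod.mk.injEq, and_true]; abel
      map_smul' := fun a u => by
        ext1 h; simp }
  have hΦ : Function.Injective Φ := by
    rw [← LinearMap.ker_eq_bot, LinearMap.ker_eq_bot']
    rintro ⟨c, v, s⟩ hu
    have hu' : ∀ h : H, c + (h : E ≃ₗᵢ[ℝ] E) v = 0 ∧ s = 0 := fun h => by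
      simpa [Φ] using congrFun hu h
    have hcv : ∀ h : H, (h : E ≃ₗᵢ[ℝ] E) v = -c := fun h =>
      (neg_eq_of_add_eq_zero_right (hu' h).1).symm
    have h1 : v = -c := by simpa using hcv 1
    have hv : v = 0 := hfix v fun h hh => by rw [hcv ⟨h, hh⟩, ← h1]
    have hc : c = 0 := by rw [hv] at h1; simpa using h1.symm
    simp [hv, hc, (hu' 1).2]
  have hrank : finrank ℝ (LinearMap.range Φ) = 2 * finrank ℝ E + 1 := by
    rw [LinearMap.finrank_range_of_inj hΦ]
    simp; ring
  obtain ⟨f, t, ht0, ht1, ⟨c, v, s⟩, hu⟩ := exists_partition_sum_mem (LinearMap.range Φ)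
    (fun u => ⟨(u.1, 0, u.2), by ext1 h; simp [Φ]⟩) (by rwa [hrank]) x
  have hu1 : ∀ h : H, c + (h : E ≃ₗᵢ[ℝ] E) v = ∑ i with f i = h, t i • x i := fun h => by
    simpa [Φ, Prod.fst_sum] using congrArg Prod.fst (congrFun hu h)
  have hu2 : ∀ h : H, s = ∑ i with f i = h, t i := fun h => by
    simpa [Φ, Prod.snd_sum] using congrArg Prod.snd (congrFun hu h)
  -- Every class has weight `s`, and the total weight is one.
  have hs : s ≠ 0 := by
    rintro rfl
    rw [← Finset.sum_fiberwise Finset.univ f t] at ht1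
    simp [← hu2] at ht1
  have hs0 : 0 ≤ s := by
    rw [hu2 1]
    exact Finset.sum_nonneg fun i _ => ht0 i
  refine ⟨f, fun i => s⁻¹ * t i, fun i => mul_nonneg (inv_nonneg.2 hs0) (ht0 i), fun h => ?_,
    s⁻¹ • c, s⁻¹ • v, fun h => ?_⟩
  · rw [← Finset.mul_sum, ← hu2, inv_mul_cancel₀ hs]
  · simp only [mul_smul]
    rw [← Finset.smul_sum, ← hu1, map_smul, smul_add]

/-! ### Symmetries of generic orbits -/

/-- Two families with the same Gram matrix, the first of which spans, are related by a linear
isometry. -/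
theorem exists_linearIsometryEquiv_of_inner_eq {E : Type*} [NormedAddCommGroup E]
    [InnerProductSpace ℝ E] [FiniteDimensional ℝ E] {κ : Type*} [Fintype κ] {x y : κ → E}
    (hspan : Submodule.span ℝ (Set.range x) = ⊤)
    (h : ∀ i j, inner ℝ (x i) (x j) = inner ℝ (y i) (y j)) :
    ∃ T : E ≃ₗᵢ[ℝ] E, ∀ i, T (x i) = y i := by
  classical
  let A := Fintype.linearCombination ℝ x
  let B := Fintype.linearCombination ℝ y
  have hAB : ∀ a, ‖A a‖ = ‖B a‖ := by
    intro a
    have h1 : inner ℝ (A a) (A a) = inner ℝ (B a) (B a) := by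
      simp only [A, B, Fintype.linearCombination_apply, sum_inner, inner_sum, inner_smul_left,
        inner_smul_right, h]
    rw [real_inner_self_eq_norm_sq, real_inner_self_eq_norm_sq] at h1
    exact (sq_eq_sq₀ (norm_nonneg _) (norm_nonneg _)).1 h1
  obtain ⟨s, hs⟩ := A.exists_rightInverse_of_surjective
    (by rw [Fintype.range_linearCombination, hspan])
  have hs' : ∀ e, A (s e) = e := fun e => LinearMap.congr_fun hs e
  let T : E →ₗᵢ[ℝ] E := ⟨B ∘ₗ s, fun e => by
    rw [LinearMap.comp_apply, ← hAB, hs']⟩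
  refine ⟨T.toLinearIsometryEquiv rfl, fun i => ?_⟩
  -- Equal Gram matrices make the two combination maps have the same kernel.
  have h1 : B (s (x i) - Pi.single i 1) = 0 := by
    rw [← norm_eq_zero, ← hAB, map_sub, hs']
    simp [A]
  rw [map_sub, sub_eq_zero] at h1
  calc T (x i) = B (s (x i)) := rfl
    _ = y i := by rw [h1]; simp [B]

namespace LinearIsometryEquiv

variable {E : Type*} [NormedAddCommGroup E] [InnerProductSpace ℝ E]

/-- A point `v` whose orbit under `H` spans, is free, and has no coincidences among its inner
products beyond those shared by the orbits of all points. -/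
structure IsGenericSeed (H : Subgroup (E ≃ₗᵢ[ℝ] E)) (v : E) : Prop where
  span_eq_top : Submodule.span ℝ (Set.range fun h : H => (h : E ≃ₗᵢ[ℝ] E) v) = ⊤
  free : ∀ h ∈ H, h v = v → h = 1
  rigid : ∀ π : Equiv.Perm H,
    (∀ g k : H, inner ℝ ((g : E ≃ₗᵢ[ℝ] E) v) ((k : E ≃ₗᵢ[ℝ] E) v) =
      inner ℝ ((π g : E ≃ₗᵢ[ℝ] E) v) ((π k : E ≃ₗᵢ[ℝ] E) v)) →
    ∀ (w : E) (g k : H), inner ℝ ((g : E ≃ₗᵢ[ℝ] E) w) ((k : E ≃ₗᵢ[ℝ] E) w) =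
      inner ℝ ((π g : E ≃ₗᵢ[ℝ] E) w) ((π k : E ≃ₗᵢ[ℝ] E) w)

variable {H : Subgroup (E ≃ₗᵢ[ℝ] E)} {v₀ : E}

theorem subgroup_mul_apply (g k : H) (x : E) :
    ((g * k : H) : E ≃ₗᵢ[ℝ] E) x = (g : E ≃ₗᵢ[ℝ] E) ((k : E ≃ₗᵢ[ℝ] E) x) := rfl

theorem subgroup_inv_apply_eq_iff (k : H) (x y : E) :
    ((k⁻¹ : H) : E ≃ₗᵢ[ℝ] E) x = y ↔ x = (k : E ≃ₗᵢ[ℝ] E) y :=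
  (k : E ≃ₗᵢ[ℝ] E).symm_apply_eq

theorem IsGenericSeed.injective_orbit {v : E} (hv : IsGenericSeed H v) :
    Function.Injective fun h : H => (h : E ≃ₗᵢ[ℝ] E) v := by
  intro g k h1
  have h2 := hv.free _ (k⁻¹ * g).2 (by rwa [subgroup_mul_apply, subgroup_inv_apply_eq_iff])
  have h3 : k⁻¹ * g = 1 := Subtype.ext h2
  exact (inv_mul_eq_one.1 h3).symm

theorem eq_of_forall_inner_eq_zero
    (hspan : Submodule.span ℝ (Set.range fun h : H => (h : E ≃ₗᵢ[ℝ] E) v₀) = ⊤) {u : E}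
    (hu : ∀ k : H, inner ℝ u ((k : E ≃ₗᵢ[ℝ] E) v₀) = 0) : u = 0 := by
  have h1 : ∀ y ∈ Submodule.span ℝ (Set.range fun h : H => (h : E ≃ₗᵢ[ℝ] E) v₀),
      inner ℝ u y = 0 := by
    intro y hy
    induction hy using Submodule.span_induction with
    | mem y hy => obtain ⟨k, rfl⟩ := hy; exact hu k
    | zero => simp
    | add y z _ _ hy hz => rw [inner_add_right, hy, hz, add_zero]
    | smul a y _ hy => rw [inner_smul_right, hy, mul_zero]
  exact inner_self_eq_zero.1 (h1 u (hspan ▸ Submodule.mem_top))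

/-- A permutation preserving the Gram matrices of all orbits and fixing one spanning orbit
pointwise is trivial. -/
theorem perm_eq_of_inner_eq [Finite H]
    (hspan : Submodule.span ℝ (Set.range fun h : H => (h : E ≃ₗᵢ[ℝ] E) v₀) = ⊤)
    (π : Equiv.Perm H)
    (hπ : ∀ (w : E) (g k : H), inner ℝ ((g : E ≃ₗᵢ[ℝ] E) w) ((k : E ≃ₗᵢ[ℝ] E) w) =
      inner ℝ ((π g : E ≃ₗᵢ[ℝ] E) w) ((π k : E ≃ₗᵢ[ℝ] E) w))
    (hv₀ : ∀ g : H, (π g : E ≃ₗᵢ[ℝ] E) v₀ = (g : E ≃ₗᵢ[ℝ] E) v₀) (g : H) : π g = g := by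
  set m := orderOf π with hm
  have hmpos : 0 < m := orderOf_pos π
  -- Sum over a full period of `π`: replacing `g` by `π g` only shifts the summation index, which
  -- gives the orthogonality `horth`.
  let Z : H → E → E := fun k w => ∑ j ∈ Finset.range m, (((π ^ j) k : H) : E ≃ₗᵢ[ℝ] E) w
  have hZadd : ∀ (k : H) (a : ℝ) (w w' : E), Z k (w + a • w') = Z k w + a • Z k w' := by
    intro k a w w'
    simp only [Z, map_add, map_smul, Finset.sum_add_distrib, Finset.smul_sum]
  have hZv₀ : ∀ k, Z k v₀ = (m : ℝ) • (k : E ≃ₗᵢ[ℝ] E) v₀ := by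
    intro k
    have : ∀ j : ℕ, (((π ^ j) k : H) : E ≃ₗᵢ[ℝ] E) v₀ = (k : E ≃ₗᵢ[ℝ] E) v₀ := by
      intro j
      induction j with
      | zero => simp
      | succ j ih => rw [pow_succ', Equiv.Perm.mul_apply, hv₀, ih]
    simp [Z, this, Nat.cast_smul_eq_nsmul]
  have horth : ∀ w k, inner ℝ ((g : E ≃ₗᵢ[ℝ] E) w - (π g : E ≃ₗᵢ[ℝ] E) w) (Z k w) = 0 := by
    intro w k
    rw [inner_sub_left, sub_eq_zero]
    simp only [Z, inner_sum]
    let F : ℕ → ℝ := fun j =>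
      inner ℝ ((π g : E ≃ₗᵢ[ℝ] E) w) ((((π ^ j) k : H) : E ≃ₗᵢ[ℝ] E) w)
    have h1 : ∀ j, inner ℝ ((g : E ≃ₗᵢ[ℝ] E) w) ((((π ^ j) k : H) : E ≃ₗᵢ[ℝ] E) w) = F (j + 1) := by
      intro j
      simp only [F]
      rw [hπ, pow_succ', Equiv.Perm.mul_apply]
    simp only [h1]
    change _ = ∑ j ∈ Finset.range m, F j
    have h2 := Finset.sum_range_succ F m
    rw [Finset.sum_range_succ'] at h2
    have h3 : F m = F 0 := by simp [F, hm, pow_orderOf_eq_one]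
    linarith
  refine Subtype.ext (LinearIsometryEquiv.ext fun x => ?_)
  symm
  rw [← sub_eq_zero]
  refine eq_of_forall_inner_eq_zero hspan fun k => ?_
  -- Polarise at `v₀ + a • x`: the `v₀` part of the difference cancels by `hv₀`, and comparing `a =
  -- 1` with `a = -1` isolates the inner product with the orbit of `v₀`.
  have h4 : ∀ a : ℝ, inner ℝ (a • ((g : E ≃ₗᵢ[ℝ] E) x - (π g : E ≃ₗᵢ[ℝ] E) x))
      ((m : ℝ) • (k : E ≃ₗᵢ[ℝ] E) v₀ + a • Z k x) = 0 := by
    intro a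
    have := horth (v₀ + a • x) k
    rw [hZadd, hZv₀, map_add, map_add, map_smul, map_smul, hv₀, add_sub_add_left_eq_sub,
      ← smul_sub] at this
    exact this
  have h5 := h4 1
  have h6 := h4 (-1)
  simp only [inner_smul_left, inner_add_right, inner_smul_right] at h5 h6
  simp only [map_one, map_neg, one_mul, neg_mul, mul_neg, neg_neg] at h5 h6
  have h7 : (m : ℝ) * inner ℝ ((g : E ≃ₗᵢ[ℝ] E) x - (π g : E ≃ₗᵢ[ℝ] E) x)
      ((k : E ≃ₗᵢ[ℝ] E) v₀) = 0 := by linarith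
  exact (mul_eq_zero.1 h7).resolve_left (by positivity)

/-- If the orbit of `v₀` has no symmetries outside `H`, then a permutation of `H` preserving the
Gram matrices of all orbits is a left translation. -/
theorem exists_perm_eq_mul_left [FiniteDimensional ℝ E] [Finite H]
    (hspan : Submodule.span ℝ (Set.range fun h : H => (h : E ≃ₗᵢ[ℝ] E) v₀) = ⊤)
    (hsymm : ∀ T : E ≃ₗᵢ[ℝ] E,
      (∀ g : H, ∃ k : H, T ((g : E ≃ₗᵢ[ℝ] E) v₀) = (k : E ≃ₗᵢ[ℝ] E) v₀) → T ∈ H)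
    (π : Equiv.Perm H)
    (hπ : ∀ (w : E) (g k : H), inner ℝ ((g : E ≃ₗᵢ[ℝ] E) w) ((k : E ≃ₗᵢ[ℝ] E) w) =
      inner ℝ ((π g : E ≃ₗᵢ[ℝ] E) w) ((π k : E ≃ₗᵢ[ℝ] E) w)) :
    ∃ a : H, ∀ g, π g = a * g := by
  have := Fintype.ofFinite H
  obtain ⟨T, hT⟩ := exists_linearIsometryEquiv_of_inner_eq hspan (hπ v₀)
  let a : H := ⟨T, hsymm T fun g => ⟨π g, hT g⟩⟩
  refine ⟨a, fun g => ?_⟩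
  -- The stabiliser of `v₀` may be nontrivial, so agreement of `π` and `a` on the orbit of `v₀` does
  -- not by itself identify them as permutations.
  have h := perm_eq_of_inner_eq hspan (π.trans (Equiv.mulLeft a⁻¹)) (fun w g k => by
      rw [hπ]
      simp only [Equiv.trans_apply, Equiv.coe_mulLeft, subgroup_mul_apply,
        LinearIsometryEquiv.inner_map_map])
    (fun g => by
      rw [Equiv.trans_apply, Equiv.coe_mulLeft, subgroup_mul_apply, subgroup_inv_apply_eq_iff]
      exact (hT g).symm) g
  rw [Equiv.trans_apply, Equiv.coe_mulLeft] at h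
  exact inv_mul_eq_iff_eq_mul.1 h

/-- `T` induces a permutation of `H` preserving the Gram matrix of the orbit of `v`. Rigidity makes
it a left translation by some `a`, so `T` agrees with `a` on a spanning set. -/
theorem IsGenericSeed.mem_of_maps_orbit [FiniteDimensional ℝ E] [Finite H]
    (hspan : Submodule.span ℝ (Set.range fun h : H => (h : E ≃ₗᵢ[ℝ] E) v₀) = ⊤)
    (hsymm : ∀ T : E ≃ₗᵢ[ℝ] E,
      (∀ g : H, ∃ k : H, T ((g : E ≃ₗᵢ[ℝ] E) v₀) = (k : E ≃ₗᵢ[ℝ] E) v₀) → T ∈ H)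
    {v : E} (hv : IsGenericSeed H v) (T : E ≃ₗᵢ[ℝ] E)
    (hT : ∀ g : H, ∃ k : H, T ((g : E ≃ₗᵢ[ℝ] E) v) = (k : E ≃ₗᵢ[ℝ] E) v) : T ∈ H := by
  choose σ hσ using hT
  have hσi : Function.Injective σ := by
    intro g k hgk
    exact hv.injective_orbit (T.injective (by rw [hσ, hσ, hgk]))
  let π : Equiv.Perm H := Equiv.ofBijective σ (Finite.injective_iff_bijective.1 hσi)
  have hπ : ∀ g, π g = σ g := fun _ => rfl
  obtain ⟨a, ha⟩ := exists_perm_eq_mul_left hspan hsymm π (hv.rigid π fun g k => by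
    rw [hπ, hπ, ← hσ, ← hσ, LinearIsometryEquiv.inner_map_map])
  have h4 : T.toLinearEquiv.toLinearMap = (a : E ≃ₗᵢ[ℝ] E).toLinearEquiv.toLinearMap := by
    refine LinearMap.ext_on_range hv.span_eq_top fun g => ?_
    have h5 := hσ g
    rw [← hπ, ha] at h5
    exact h5
  have h6 : T = a := LinearIsometryEquiv.ext fun x => LinearMap.congr_fun h4 x
  rw [h6]
  exact a.2

end LinearIsometryEquiv

/-! ### Isometries, extreme points and centroids of orbits -/

namespace IsometryEquiv

variable {E : Type*} [NormedAddCommGroup E] [NormedSpace ℝ E]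

theorem image_convexHull (φ : E ≃ᵢ E) (s : Set E) :
    φ '' convexHull ℝ s = convexHull ℝ (φ '' s) :=
  φ.toRealAffineIsometryEquiv.toAffineEquiv.toAffineMap.image_convexHull s

theorem image_extremePoints {F : Type*} [NormedAddCommGroup F] [NormedSpace ℝ F] (φ : E ≃ᵢ F)
    (s : Set E) :
    φ '' s.extremePoints ℝ = (φ '' s).extremePoints ℝ := by
  ext b
  obtain ⟨a, rfl⟩ := φ.surjective b
  have : ∀ x y, φ '' openSegment ℝ x y = openSegment ℝ (φ x) (φ y) :=
    image_openSegment ℝ φ.toRealAffineIsometryEquiv.toAffineEquiv.toAffineMap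
  simp only [mem_extremePoints, φ.surjective.forall,
    φ.injective.mem_set_image, φ.injective.eq_iff, ← this]

theorem apply_eq_toRealLinearIsometryEquiv_add (φ : E ≃ᵢ E) (x : E) :
    φ x = φ.toRealLinearIsometryEquiv x + φ 0 := by
  rw [toRealLinearIsometryEquiv_apply, sub_add_cancel]

/-- An isometry permuting a finite family fixes its centroid. -/
theorem apply_centroid_eq {κ : Type*} [Fintype κ] [Nonempty κ] (φ : E ≃ᵢ E) {y : κ → E}
    (hy : Function.Injective y) (h : ∀ k, ∃ k', φ (y k) = y k') :
    φ ((Fintype.card κ : ℝ)⁻¹ • ∑ k, y k) = (Fintype.card κ : ℝ)⁻¹ • ∑ k, y k := by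
  choose σ hσ using h
  have hσi : Function.Injective σ := fun i j hij => hy (φ.injective (by rw [hσ, hσ, hij]))
  let π : Equiv.Perm κ := Equiv.ofBijective σ (Finite.injective_iff_bijective.1 hσi)
  have h1 : ∑ k, φ (y k) = ∑ k, y k := by
    simp only [hσ]
    exact Equiv.sum_comp π y
  have h2 : ∑ k, φ (y k) = φ.toRealLinearIsometryEquiv (∑ k, y k) + (Fintype.card κ : ℝ) • φ 0 := by
    simp only [fun k => φ.apply_eq_toRealLinearIsometryEquiv_add (y k), Finset.sum_add_distrib,
      map_sum]
    simp [Nat.cast_smul_eq_nsmul]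
  rw [φ.apply_eq_toRealLinearIsometryEquiv_add, map_smul]
  rw [h1] at h2
  conv_rhs => rw [h2]
  rw [smul_add, smul_smul, inv_mul_cancel₀ (by positivity), one_smul]

end IsometryEquiv

/-- By strict convexity, points of a sphere are extreme in the ball, hence in any smaller set
containing them. -/
theorem extremePoints_convexHull_of_subset_sphere {E : Type*} [NormedAddCommGroup E]
    [NormedSpace ℝ E] [StrictConvexSpace ℝ E] {S : Set E} {c : E} {r : ℝ}
    (hS : S ⊆ Metric.sphere c r) : (convexHull ℝ S).extremePoints ℝ = S := by
  refine extremePoints_convexHull_subset.antisymm fun x hx => ?_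
  refine inter_extremePoints_subset_extremePoints_of_subset
    (convexHull_min (hS.trans Metric.sphere_subset_closedBall) (convex_closedBall c r))
    ⟨subset_convexHull ℝ S hx, ?_⟩
  rcases eq_or_ne r 0 with rfl | hr
  · rw [Metric.closedBall_zero, extremePoints_singleton]
    simpa using hS hx
  · exact StrictConvexSpace.sphere_subset_extremePoints_closedBall c hr (hS hx)

namespace LinearIsometryEquiv

variable {E : Type*} [NormedAddCommGroup E] [InnerProductSpace ℝ E]

/-- The linear isometries, as isometries. -/
def toIsometryEquivHom : (E ≃ₗᵢ[ℝ] E) →* (E ≃ᵢ E) where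
  toFun T := T.toIsometryEquiv
  map_one' := rfl
  map_mul' _ _ := rfl

/-- The linear isometries, as isometries fixing `c`. -/
def isometryFixingHom (c : E) : (E ≃ₗᵢ[ℝ] E) →* (E ≃ᵢ E) :=
  (MulAut.conj (IsometryEquiv.addLeft c)).toMonoidHom.comp toIsometryEquivHom

theorem isometryFixingHom_apply (c : E) (T : E ≃ₗᵢ[ℝ] E) (x : E) :
    isometryFixingHom c T x = c + T (x - c) := by
  change c + T (-c + x) = _
  rw [neg_add_eq_sub]

theorem isometryFixingHom_apply_add (c : E) (T : E ≃ₗᵢ[ℝ] E) (x : E) :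
    isometryFixingHom c T (c + x) = c + T x := by
  rw [isometryFixingHom_apply, add_sub_cancel_left]

theorem isometryFixingHom_injective (c : E) : Function.Injective (isometryFixingHom c) := by
  intro T T' h
  ext x
  have := DFunLike.congr_fun h (c + x)
  simpa [isometryFixingHom_apply_add] using this

theorem eq_isometryFixingHom_of_apply_eq {φ : E ≃ᵢ E} {c : E} (h : φ c = c) :
    φ = isometryFixingHom c φ.toRealLinearIsometryEquiv := by
  ext x
  rw [isometryFixingHom_apply, map_sub]
  have h1 := φ.apply_eq_toRealLinearIsometryEquiv_add x
  have h2 := φ.apply_eq_toRealLinearIsometryEquiv_add c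
  rw [h] at h2
  have h3 : φ 0 = c - φ.toRealLinearIsometryEquiv c := eq_sub_of_add_eq' h2.symm
  rw [h1, h3]
  abel

variable {H : Subgroup (E ≃ₗᵢ[ℝ] E)}

theorem sum_orbit_eq_zero [Fintype H] (hfix : ∀ w : E, (∀ h ∈ H, h w = w) → w = 0) (v : E) :
    ∑ h : H, (h : E ≃ₗᵢ[ℝ] E) v = 0 := by
  refine hfix _ fun k hk => ?_
  rw [map_sum]
  exact Equiv.sum_comp (Equiv.mulLeft (⟨k, hk⟩ : H)) fun h : H => (h : E ≃ₗᵢ[ℝ] E) v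

theorem centroid_orbit_eq [Fintype H] (hfix : ∀ w : E, (∀ h ∈ H, h w = w) → w = 0) (c v : E) :
    (Fintype.card H : ℝ)⁻¹ • ∑ h : H, (c + (h : E ≃ₗᵢ[ℝ] E) v) = c := by
  rw [Finset.sum_add_distrib, sum_orbit_eq_zero hfix, add_zero]
  simp [← Nat.cast_smul_eq_nsmul ℝ, smul_smul]

theorem extremePoints_convexHull_orbit (H : Subgroup (E ≃ₗᵢ[ℝ] E)) (c v : E) :
    (convexHull ℝ (Set.range fun h : H => c + (h : E ≃ₗᵢ[ℝ] E) v)).extremePoints ℝ =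
      Set.range fun h : H => c + (h : E ≃ₗᵢ[ℝ] E) v := by
  refine extremePoints_convexHull_of_subset_sphere (c := c) (r := ‖v‖) ?_
  rintro _ ⟨h, rfl⟩
  simp

theorem affineSpan_orbit_eq_top [Fintype H] (hfix : ∀ w : E, (∀ h ∈ H, h w = w) → w = 0)
    (c : E) {v : E} (hspan : Submodule.span ℝ (Set.range fun h : H => (h : E ≃ₗᵢ[ℝ] E) v) = ⊤) :
    affineSpan ℝ (Set.range fun h : H => c + (h : E ≃ₗᵢ[ℝ] E) v) = ⊤ := by
  set S := Set.range fun h : H => c + (h : E ≃ₗᵢ[ℝ] E) v with hS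
  have hc : c ∈ affineSpan ℝ S := by
    refine convexHull_subset_affineSpan S ?_
    rw [← centroid_orbit_eq hfix c v, Finset.smul_sum]
    exact (convex_convexHull ℝ S).sum_mem (fun _ _ => by positivity) (by simp) fun h _ =>
      subset_convexHull ℝ S ⟨h, rfl⟩
  rw [← AffineSubspace.direction_eq_top_iff_of_nonempty ⟨c, hc⟩, eq_top_iff, ← hspan,
    Submodule.span_le]
  rintro _ ⟨h, rfl⟩
  have h1 : c + (h : E ≃ₗᵢ[ℝ] E) v ∈ affineSpan ℝ S := subset_affineSpan ℝ S ⟨h, rfl⟩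
  simpa using AffineSubspace.vsub_mem_direction h1 hc

theorem image_convexHull_orbit {T : E ≃ₗᵢ[ℝ] E} (hT : T ∈ H) (c v : E) :
    isometryFixingHom c T '' convexHull ℝ (Set.range fun h : H => c + (h : E ≃ₗᵢ[ℝ] E) v) =
      convexHull ℝ (Set.range fun h : H => c + (h : E ≃ₗᵢ[ℝ] E) v) := by
  rw [IsometryEquiv.image_convexHull, ← Set.range_comp]
  congr 1
  have : (isometryFixingHom c T ∘ fun h : H => c + (h : E ≃ₗᵢ[ℝ] E) v) =
      (fun h : H => c + (h : E ≃ₗᵢ[ℝ] E) v) ∘ Equiv.mulLeft (⟨T, hT⟩ : H) := by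
    ext1 h
    simp only [Function.comp_apply, isometryFixingHom_apply_add]
    rfl
  rw [this, (Equiv.mulLeft (⟨T, hT⟩ : H)).surjective.range_comp]

end LinearIsometryEquiv

open LinearIsometryEquiv

/-! ### Orbit polytopes and their isometry groups -/

section Polytope

variable {d : ℕ}

theorem isVertexTransitivePolytope_convexHull_orbit
    {H : Subgroup (EuclideanSpace ℝ (Fin d) ≃ₗᵢ[ℝ] EuclideanSpace ℝ (Fin d))} [Finite H]
    (hfix : ∀ w : EuclideanSpace ℝ (Fin d), (∀ h ∈ H, h w = w) → w = 0)
    (c : EuclideanSpace ℝ (Fin d)) {v : EuclideanSpace ℝ (Fin d)} (hv : IsGenericSeed H v) :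
    IsVertexTransitivePolytope (convexHull ℝ (Set.range fun h : H =>
      c + (h : EuclideanSpace ℝ (Fin d) ≃ₗᵢ[ℝ] EuclideanSpace ℝ (Fin d)) v)) := by
  have := Fintype.ofFinite H
  refine ⟨⟨⟨(Set.finite_range _).toFinset, by rw [Set.Finite.coe_toFinset]⟩, ?_⟩, ?_⟩
  · rw [affineSpan_convexHull, affineSpan_orbit_eq_top hfix c hv.span_eq_top]
  · rw [extremePoints_convexHull_orbit]
    rintro _ ⟨g, rfl⟩ _ ⟨k, rfl⟩
    refine ⟨isometryFixingHom c (k * g⁻¹ : H), image_convexHull_orbit (k * g⁻¹ : H).2 c v, ?_⟩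
    rw [isometryFixingHom_apply_add, ← subgroup_mul_apply, inv_mul_cancel_right]

/-- An isometry of the hull permutes its extreme points, so it fixes their centroid `c`; its linear
part permutes the orbit of `v` and therefore lies in `H`. -/
theorem isoGroup_convexHull_orbit
    {H : Subgroup (EuclideanSpace ℝ (Fin d) ≃ₗᵢ[ℝ] EuclideanSpace ℝ (Fin d))} [Finite H]
    {v₀ : EuclideanSpace ℝ (Fin d)}
    (hfix : ∀ w : EuclideanSpace ℝ (Fin d), (∀ h ∈ H, h w = w) → w = 0)
    (hspan : Submodule.span ℝ (Set.range fun h : H =>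
      (h : EuclideanSpace ℝ (Fin d) ≃ₗᵢ[ℝ] EuclideanSpace ℝ (Fin d)) v₀) = ⊤)
    (hsymm : ∀ T : EuclideanSpace ℝ (Fin d) ≃ₗᵢ[ℝ] EuclideanSpace ℝ (Fin d),
      (∀ g : H, ∃ k : H, T ((g : EuclideanSpace ℝ (Fin d) ≃ₗᵢ[ℝ] EuclideanSpace ℝ (Fin d)) v₀) =
        (k : EuclideanSpace ℝ (Fin d) ≃ₗᵢ[ℝ] EuclideanSpace ℝ (Fin d)) v₀) → T ∈ H)
    (c : EuclideanSpace ℝ (Fin d)) {v : EuclideanSpace ℝ (Fin d)} (hv : IsGenericSeed H v) :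
    isoGroup (convexHull ℝ (Set.range fun h : H =>
      c + (h : EuclideanSpace ℝ (Fin d) ≃ₗᵢ[ℝ] EuclideanSpace ℝ (Fin d)) v)) =
      H.map (isometryFixingHom c) := by
  have := Fintype.ofFinite H
  ext φ
  constructor
  · intro hφ
    have hφ' : φ '' _ = _ := hφ
    have hS := φ.image_extremePoints (convexHull ℝ (Set.range fun h : H =>
      c + (h : EuclideanSpace ℝ (Fin d) ≃ₗᵢ[ℝ] EuclideanSpace ℝ (Fin d)) v))
    rw [hφ', extremePoints_convexHull_orbit] at hS
    have hperm : ∀ g : H, ∃ k : H,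
        φ (c + (g : EuclideanSpace ℝ (Fin d) ≃ₗᵢ[ℝ] EuclideanSpace ℝ (Fin d)) v) =
          c + (k : EuclideanSpace ℝ (Fin d) ≃ₗᵢ[ℝ] EuclideanSpace ℝ (Fin d)) v := by
      intro g
      obtain ⟨k, hk⟩ := hS.subset ⟨_, ⟨g, rfl⟩, rfl⟩
      exact ⟨k, hk.symm⟩
    have hc := φ.apply_centroid_eq
      (y := fun h : H => c + (h : EuclideanSpace ℝ (Fin d) ≃ₗᵢ[ℝ] EuclideanSpace ℝ (Fin d)) v)
      (fun g k h => hv.injective_orbit (add_left_cancel h)) hperm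
    rw [centroid_orbit_eq hfix] at hc
    have hφc := eq_isometryFixingHom_of_apply_eq hc
    refine ⟨φ.toRealLinearIsometryEquiv, hv.mem_of_maps_orbit hspan hsymm _ fun g => ?_, hφc.symm⟩
    obtain ⟨k, hk⟩ := hperm g
    rw [hφc, isometryFixingHom_apply_add] at hk
    exact ⟨k, add_left_cancel hk⟩
  · rintro ⟨T, hT, rfl⟩
    exact image_convexHull_orbit hT c v

/-- The isometry group of a vertex-transitive polytope is, up to moving the centroid of the polytope
to the origin, a finite group of linear isometries without nonzero fixed points which is the full
symmetry group of a spanning orbit. -/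
theorem IsVertexTransitivePolytope.exists_linear_group {Q : Set (EuclideanSpace ℝ (Fin d))}
    (hQ : IsVertexTransitivePolytope Q) :
    ∃ (H : Subgroup (EuclideanSpace ℝ (Fin d) ≃ₗᵢ[ℝ] EuclideanSpace ℝ (Fin d)))
      (p v₀ : EuclideanSpace ℝ (Fin d)), Finite H ∧ isoGroup Q = H.map (isometryFixingHom p) ∧
      (∀ w : EuclideanSpace ℝ (Fin d), (∀ h ∈ H, h w = w) → w = 0) ∧
      Submodule.span ℝ (Set.range fun h : H =>
        (h : EuclideanSpace ℝ (Fin d) ≃ₗᵢ[ℝ] EuclideanSpace ℝ (Fin d)) v₀) = ⊤ ∧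
      ∀ T : EuclideanSpace ℝ (Fin d) ≃ₗᵢ[ℝ] EuclideanSpace ℝ (Fin d),
        (∀ g : H, ∃ k : H, T ((g : EuclideanSpace ℝ (Fin d) ≃ₗᵢ[ℝ] EuclideanSpace ℝ (Fin d)) v₀) =
          (k : EuclideanSpace ℝ (Fin d) ≃ₗᵢ[ℝ] EuclideanSpace ℝ (Fin d)) v₀) → T ∈ H := by
  obtain ⟨⟨⟨S₀, rfl⟩, hspanQ⟩, htrans⟩ := hQ
  set Q := convexHull ℝ (S₀ : Set (EuclideanSpace ℝ (Fin d))) with hQdef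
  set S := Q.extremePoints ℝ with hS
  have hSfin : S.Finite := S₀.finite_toSet.subset extremePoints_convexHull_subset
  have hQcpt : IsCompact Q := S₀.finite_toSet.isCompact_convexHull ℝ
  have hQS : convexHull ℝ S = Q := by
    rw [← closure_convexHull_extremePoints hQcpt (convex_convexHull ℝ _)]
    exact ((hSfin.isCompact_convexHull ℝ).isClosed.closure_eq).symm
  have hQne : Q.Nonempty := by
    rw [← affineSpan_nonempty ℝ, hspanQ]
    exact ⟨0, trivial⟩
  obtain ⟨s₀, hs₀⟩ := hQcpt.extremePoints_nonempty hQne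
  have hspanS : affineSpan ℝ S = ⊤ := by rw [← affineSpan_convexHull, hQS, hspanQ]
  have := hSfin.fintype
  have : Nonempty S := ⟨⟨s₀, hs₀⟩⟩
  set p := (Fintype.card S : ℝ)⁻¹ • ∑ s : S, (s : EuclideanSpace ℝ (Fin d)) with hp
  have hsum : ∑ s : S, ((s : EuclideanSpace ℝ (Fin d)) - p) = 0 := by
    rw [Finset.sum_sub_distrib, Finset.sum_const, Finset.card_univ, ← Nat.cast_smul_eq_nsmul ℝ,
      hp, smul_smul, mul_inv_cancel₀ (by positivity), one_smul, sub_self]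
  have hspan' : Submodule.span ℝ ((fun x => x - p) '' S) = ⊤ := by
    have h1 : vectorSpan ℝ S = ⊤ := by
      rw [← direction_affineSpan, hspanS, AffineSubspace.direction_top]
    rw [eq_top_iff, ← h1, vectorSpan_def, Submodule.span_le]
    rintro _ ⟨x, hx, y, hy, rfl⟩
    have h2 := Submodule.sub_mem (Submodule.span ℝ ((fun x => x - p) '' S))
      (Submodule.subset_span ⟨x, hx, rfl⟩) (Submodule.subset_span ⟨y, hy, rfl⟩)
    simpa using h2
  have hmaps : ∀ φ ∈ isoGroup Q, ∀ s ∈ S, φ s ∈ S := by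
    intro φ hφ s hs
    have hφ' : φ '' Q = Q := hφ
    have h1 := φ.image_extremePoints Q
    rw [hφ'] at h1
    exact h1.subset ⟨s, hs, rfl⟩
  have hfixp : ∀ φ ∈ isoGroup Q, φ p = p := fun φ hφ =>
    φ.apply_centroid_eq (y := fun s : S => (s : EuclideanSpace ℝ (Fin d)))
      Subtype.val_injective fun s => ⟨⟨_, hmaps φ hφ s s.2⟩, rfl⟩
  have hlin : ∀ φ ∈ isoGroup Q, isometryFixingHom p φ.toRealLinearIsometryEquiv = φ :=
    fun φ hφ => (eq_isometryFixingHom_of_apply_eq (hfixp φ hφ)).symm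
  let H := (isoGroup Q).comap (isometryFixingHom p)
  have hHS : ∀ h ∈ H, ∀ s ∈ S, p + h (s - p) ∈ S := by
    intro h hh s hs
    have h1 := hmaps _ hh s hs
    rwa [isometryFixingHom_apply] at h1
  have horbit : ∀ s ∈ S, ∃ h ∈ H, h (s₀ - p) = s - p := by
    intro s hs
    obtain ⟨φ, hφ, hφs⟩ := htrans s₀ hs₀ s hs
    refine ⟨φ.toRealLinearIsometryEquiv, ?_, ?_⟩
    · change isometryFixingHom p _ ∈ isoGroup Q
      rwa [hlin φ hφ]
    · rw [← hlin φ hφ, isometryFixingHom_apply] at hφs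
      rw [← hφs, add_sub_cancel_left]
  have hspan : Submodule.span ℝ (Set.range fun h : H =>
      (h : EuclideanSpace ℝ (Fin d) ≃ₗᵢ[ℝ] EuclideanSpace ℝ (Fin d)) (s₀ - p)) = ⊤ := by
    rw [eq_top_iff, ← hspan']
    refine Submodule.span_mono ?_
    rintro _ ⟨s, hs, rfl⟩
    obtain ⟨h, hh, hhs⟩ := horbit s hs
    exact ⟨⟨h, hh⟩, hhs⟩
  refine ⟨H, p, s₀ - p, ?_, ?_, ?_, hspan, ?_⟩
  · refine Finite.of_injective (fun (h : H) (s : S) => (⟨_, hHS h h.2 s s.2⟩ : S)) ?_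
    intro h k hhk
    have h1 : (h : EuclideanSpace ℝ (Fin d) ≃ₗᵢ[ℝ] EuclideanSpace ℝ (Fin d)).toLinearEquiv.toLinearMap =
        (k : EuclideanSpace ℝ (Fin d) ≃ₗᵢ[ℝ] EuclideanSpace ℝ (Fin d)).toLinearEquiv.toLinearMap := by
      refine LinearMap.ext_on hspan' ?_
      rintro _ ⟨s, hs, rfl⟩
      exact add_left_cancel (congrArg Subtype.val (congrFun hhk ⟨s, hs⟩))
    exact Subtype.ext (LinearIsometryEquiv.ext fun x => LinearMap.congr_fun h1 x)
  · rw [Subgroup.map_comap_eq, eq_comm, inf_eq_right]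
    exact fun φ hφ => ⟨_, hlin φ hφ⟩
  · intro w hw
    -- A fixed vector has the same inner product with all centred vertices; these sum to zero, so it
    -- is orthogonal to a spanning set.
    have h1 : ∀ s : S, inner ℝ w ((s : EuclideanSpace ℝ (Fin d)) - p) = inner ℝ w (s₀ - p) := by
      intro s
      obtain ⟨h, hh, hhs⟩ := horbit s s.2
      rw [← hhs]
      nth_rw 1 [← hw h hh]
      exact h.inner_map_map _ _
    have h2 : inner ℝ w (s₀ - p) = 0 := by
      have h3 := congrArg (inner ℝ w) hsum
      rw [inner_sum, inner_zero_right] at h3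
      simp only [h1, Finset.sum_const, nsmul_eq_mul, Finset.card_univ] at h3
      exact (mul_eq_zero.1 h3).resolve_left (by positivity)
    refine eq_of_forall_inner_eq_zero hspan fun k => ?_
    nth_rw 1 [← hw k k.2]
    rw [LinearIsometryEquiv.inner_map_map, h2]
  · intro T hT
    change isometryFixingHom p T '' Q = Q
    rw [← hQS, IsometryEquiv.image_convexHull]
    congr 1
    refine Set.eq_of_subset_of_ncard_le ?_ ?_ hSfin
    · rintro _ ⟨s, hs, rfl⟩
      obtain ⟨h, hh, hhs⟩ := horbit s hs
      obtain ⟨k, hk⟩ := hT ⟨h, hh⟩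
      rw [isometryFixingHom_apply, ← hhs]
      rw [hk]
      exact hHS k k.2 s₀ hs₀
    · rw [Set.ncard_image_of_injective _ (isometryFixingHom p T).injective]

end Polytope

/-! ### Almost every vector is a generic seed -/

namespace MeasureTheory

/-- A closed set meeting all lines of some direction in finite sets is null. -/
theorem addHaar_eq_zero_of_finite_lines {E : Type*} [NormedAddCommGroup E] [NormedSpace ℝ E]
    [FiniteDimensional ℝ E] [MeasurableSpace E] [BorelSpace E] (μ : Measure E)
    [μ.IsAddHaarMeasure] {Z : Set E} (hZ : IsClosed Z) (e : E)
    (h : ∀ x, {t : ℝ | x + t • e ∈ Z}.Finite) : μ Z = 0 := by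
  have h1 : ∀ᵐ x ∂μ, x ∈ Zᶜ := by
    refine ae_mem_of_ae_add_linearMap_mem (LinearMap.toSpanSingleton ℝ E e) volume μ
      hZ.measurableSet.compl fun x => ?_
    rw [ae_iff]
    simpa using (h x).measure_zero volume
  rw [ae_iff] at h1
  simpa using h1

end MeasureTheory

theorem finite_setOf_quadratic_eq_zero (a b : ℝ) {c : ℝ} (hc : c ≠ 0) :
    {t : ℝ | a + t * b + t ^ 2 * c = 0}.Finite := by
  open Polynomial in
  let p : ℝ[X] := C c * X ^ 2 + C b * X + C a
  have hp : p ≠ 0 := by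
    intro h
    have : p.natDegree = 2 := natDegree_quadratic hc
    rw [h] at this
    simp at this
  refine (p.rootSet_finite ℝ).subset fun t ht => ?_
  rw [Polynomial.mem_rootSet]
  refine ⟨hp, ?_⟩
  have ht' : a + t * b + t ^ 2 * c = 0 := ht
  simp [p]
  linarith

namespace LinearIsometryEquiv

open MeasureTheory

variable {E : Type*} [NormedAddCommGroup E] [InnerProductSpace ℝ E] {H : Subgroup (E ≃ₗᵢ[ℝ] E)}

theorem span_orbit_eq_top_of_linearIndependent [FiniteDimensional ℝ E] {κ : Type*} [Fintype κ]
    {a : κ → H} (hcard : Fintype.card κ = Module.finrank ℝ E) {v : E}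
    (h : LinearIndependent ℝ fun i => (a i : E ≃ₗᵢ[ℝ] E) v) :
    Submodule.span ℝ (Set.range fun h : H => (h : E ≃ₗᵢ[ℝ] E) v) = ⊤ := by
  rw [eq_top_iff, ← h.span_eq_top_of_card_eq_finrank' hcard]
  refine Submodule.span_mono ?_
  rintro _ ⟨i, rfl⟩
  exact ⟨a i, rfl⟩

theorem exists_linearIndependent_orbit [FiniteDimensional ℝ E] {v : E}
    (h : Submodule.span ℝ (Set.range fun h : H => (h : E ≃ₗᵢ[ℝ] E) v) = ⊤) :
    ∃ a : Fin (Module.finrank ℝ E) → H, LinearIndependent ℝ fun i => (a i : E ≃ₗᵢ[ℝ] E) v := by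
  obtain ⟨κ, a, -, hspan, hli⟩ :=
    exists_linearIndependent' ℝ fun h : H => (h : E ≃ₗᵢ[ℝ] E) v
  rw [h] at hspan
  let b := Module.Basis.mk hli hspan.ge
  have : Fintype κ := FiniteDimensional.fintypeBasisIndex b
  let e := Fintype.equivFinOfCardEq (Module.finrank_eq_card_basis b).symm
  exact ⟨a ∘ e.symm, hli.comp _ e.symm.injective⟩

theorem isOpen_setOf_span_orbit_eq_top [FiniteDimensional ℝ E] (H : Subgroup (E ≃ₗᵢ[ℝ] E)) :
    IsOpen {v : E | Submodule.span ℝ (Set.range fun h : H => (h : E ≃ₗᵢ[ℝ] E) v) = ⊤} := by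
  have : {v : E | Submodule.span ℝ (Set.range fun h : H => (h : E ≃ₗᵢ[ℝ] E) v) = ⊤} =
      ⋃ a : Fin (Module.finrank ℝ E) → H,
        {v : E | LinearIndependent ℝ fun i => (a i : E ≃ₗᵢ[ℝ] E) v} := by
    ext v
    simp only [Set.mem_ofPred_eq, Set.mem_iUnion]
    exact ⟨exists_linearIndependent_orbit, fun ⟨a, ha⟩ =>
      span_orbit_eq_top_of_linearIndependent (by simp) ha⟩
  rw [this]
  refine isOpen_iUnion fun a => ?_
  have hc : Continuous fun (v : E) (i : Fin (Module.finrank ℝ E)) => (a i : E ≃ₗᵢ[ℝ] E) v :=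
    continuous_pi fun i => (a i : E ≃ₗᵢ[ℝ] E).continuous
  exact isOpen_setOfPred_linearIndependent.preimage hc

theorem isOpen_setOf_isGenericSeed [FiniteDimensional ℝ E] [Finite H] :
    IsOpen {v : E | IsGenericSeed H v} := by
  have : {v : E | IsGenericSeed H v} =
      {v : E | Submodule.span ℝ (Set.range fun h : H => (h : E ≃ₗᵢ[ℝ] E) v) = ⊤} ∩
      ((⋂ h : H, {v : E | (h : E ≃ₗᵢ[ℝ] E) v = v → (h : E ≃ₗᵢ[ℝ] E) = 1}) ∩
      (⋂ π : Equiv.Perm H, {v : E | (∀ g k : H,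
        inner ℝ ((g : E ≃ₗᵢ[ℝ] E) v) ((k : E ≃ₗᵢ[ℝ] E) v) =
          inner ℝ ((π g : E ≃ₗᵢ[ℝ] E) v) ((π k : E ≃ₗᵢ[ℝ] E) v)) →
        ∀ (w : E) (g k : H), inner ℝ ((g : E ≃ₗᵢ[ℝ] E) w) ((k : E ≃ₗᵢ[ℝ] E) w) =
          inner ℝ ((π g : E ≃ₗᵢ[ℝ] E) w) ((π k : E ≃ₗᵢ[ℝ] E) w)})) := by
    ext v
    simp only [Set.mem_inter_iff, Set.mem_iInter, Set.mem_ofPred_eq]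
    exact ⟨fun h => ⟨h.1, fun k => h.2 k k.2, h.3⟩, fun h => ⟨h.1, fun k hk => h.2.1 ⟨k, hk⟩, h.2.2⟩⟩
  rw [this]
  have hc : ∀ g : H, Continuous fun v : E => (g : E ≃ₗᵢ[ℝ] E) v := fun g =>
    (g : E ≃ₗᵢ[ℝ] E).continuous
  refine (isOpen_setOf_span_orbit_eq_top H).inter
    ((isOpen_iInter_of_finite fun h => ?_).inter (isOpen_iInter_of_finite fun π => ?_))
  · simp only [imp_iff_not_or]
    exact (isClosed_eq (hc h) continuous_id).isOpen_compl.union isOpen_const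
  · simp only [imp_iff_not_or (b := ∀ (w : E) (g k : H), _)]
    refine IsOpen.union (IsClosed.isOpen_compl (s := {v : E | ∀ g k : H,
      inner ℝ ((g : E ≃ₗᵢ[ℝ] E) v) ((k : E ≃ₗᵢ[ℝ] E) v) =
        inner ℝ ((π g : E ≃ₗᵢ[ℝ] E) v) ((π k : E ≃ₗᵢ[ℝ] E) v)}) (self := ?_)) isOpen_const
    simp only [Set.ofPred_forall]
    exact isClosed_iInter fun g => isClosed_iInter fun k =>
      isClosed_eq ((hc _).inner (hc _)) ((hc _).inner (hc _))

variable [FiniteDimensional ℝ E] [MeasurableSpace E] [BorelSpace E] (μ : Measure E)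
    [μ.IsAddHaarMeasure]

theorem addHaar_setOf_span_orbit_ne_top {v₀ : E}
    (hspan : Submodule.span ℝ (Set.range fun h : H => (h : E ≃ₗᵢ[ℝ] E) v₀) = ⊤) :
    μ {v : E | Submodule.span ℝ (Set.range fun h : H => (h : E ≃ₗᵢ[ℝ] E) v) = ⊤}ᶜ = 0 := by
  refine addHaar_eq_zero_of_finite_lines μ (isOpen_setOf_span_orbit_eq_top H).isClosed_compl v₀
    fun x => ?_
  obtain ⟨a, ha⟩ := exists_linearIndependent_orbit hspan
  let b := basisOfLinearIndependentOfCardEqFinrank' _ ha (by simp)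
  have hb : ∀ i, b i = (a i : E ≃ₗᵢ[ℝ] E) v₀ := fun i => by simp [b]
  -- With this `T`, the vectors `a i (x + t • v₀)` are the images of the basis `b` under `T + t`, so
  -- they are independent unless `-t` is an eigenvalue.
  let T : Module.End ℝ E := b.constr ℝ fun i => (a i : E ≃ₗᵢ[ℝ] E) x
  refine ((T.finite_hasEigenvalue).preimage neg_injective.injOn).subset fun t ht => ?_
  by_contra hT
  refine ht ?_
  have hker : LinearMap.ker (T - algebraMap ℝ (Module.End ℝ E) (-t)) = ⊥ := by
    have h1 : ¬ T.HasEigenvalue (-t) := hT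
    rw [Module.End.hasEigenvalue_iff, not_not, Module.End.eigenspace_def] at h1
    exact h1
  refine span_orbit_eq_top_of_linearIndependent (a := a) (by simp) ?_
  have h2 := b.linearIndependent.map' _ hker
  have h3 : (fun i => (a i : E ≃ₗᵢ[ℝ] E) (x + t • v₀)) =
      (T - algebraMap ℝ (Module.End ℝ E) (-t)) ∘ b := by
    ext1 i
    have h4 : T (b i) = (a i : E ≃ₗᵢ[ℝ] E) x := b.constr_basis ℝ _ i
    rw [Function.comp_apply, LinearMap.sub_apply, h4, Module.algebraMap_end_apply, hb, map_add,
      map_smul, neg_smul, sub_neg_eq_add]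
  rw [h3]
  exact h2

/-- Failures of freeness or rigidity lie in finitely many sets, each cut out by a nontrivial linear
or quadratic equation with finitely many roots on every line of a suitable direction. -/
theorem addHaar_setOf_not_isGenericSeed [Finite H] {v₀ : E}
    (hspan : Submodule.span ℝ (Set.range fun h : H => (h : E ≃ₗᵢ[ℝ] E) v₀) = ⊤) :
    μ {v : E | IsGenericSeed H v}ᶜ = 0 := by
  have h2 : ∀ h : H, (h : E ≃ₗᵢ[ℝ] E) ≠ 1 → μ {v : E | (h : E ≃ₗᵢ[ℝ] E) v = v} = 0 := by
    intro h hh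
    obtain ⟨e, he⟩ : ∃ e, (h : E ≃ₗᵢ[ℝ] E) e ≠ e := by
      by_contra! h'
      exact hh (LinearIsometryEquiv.ext h')
    refine addHaar_eq_zero_of_finite_lines μ
      (isClosed_eq (h : E ≃ₗᵢ[ℝ] E).continuous continuous_id) e fun x => ?_
    refine Set.Subsingleton.finite fun s hs t ht => ?_
    simp only [Set.mem_ofPred_eq, map_add, map_smul] at hs ht
    have h3 : (s - t) • ((h : E ≃ₗᵢ[ℝ] E) e - e) = 0 := by
      have h4 : (s - t) • ((h : E ≃ₗᵢ[ℝ] E) e - e) =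
        ((h : E ≃ₗᵢ[ℝ] E) x + s • (h : E ≃ₗᵢ[ℝ] E) e - (x + s • e)) -
        ((h : E ≃ₗᵢ[ℝ] E) x + t • (h : E ≃ₗᵢ[ℝ] E) e - (x + t • e)) := by module
      rw [h4, hs, ht, sub_self, sub_self, sub_zero]
    exact sub_eq_zero.1 ((smul_eq_zero.1 h3).resolve_right (sub_ne_zero.2 he))
  have h3 : ∀ (π : Equiv.Perm H) (w : E) (g k : H),
      inner ℝ ((g : E ≃ₗᵢ[ℝ] E) w) ((k : E ≃ₗᵢ[ℝ] E) w) ≠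
        inner ℝ ((π g : E ≃ₗᵢ[ℝ] E) w) ((π k : E ≃ₗᵢ[ℝ] E) w) →
      μ {v : E | inner ℝ ((g : E ≃ₗᵢ[ℝ] E) v) ((k : E ≃ₗᵢ[ℝ] E) v) =
        inner ℝ ((π g : E ≃ₗᵢ[ℝ] E) v) ((π k : E ≃ₗᵢ[ℝ] E) v)} = 0 := by
    intro π w g k hw
    have hc : ∀ g : H, Continuous fun v : E => (g : E ≃ₗᵢ[ℝ] E) v := fun g =>
      (g : E ≃ₗᵢ[ℝ] E).continuous
    refine addHaar_eq_zero_of_finite_lines μ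
      (isClosed_eq ((hc _).inner (hc _)) ((hc _).inner (hc _))) w fun x => ?_
    refine (finite_setOf_quadratic_eq_zero
      (inner ℝ ((g : E ≃ₗᵢ[ℝ] E) x) ((k : E ≃ₗᵢ[ℝ] E) x) -
        inner ℝ ((π g : E ≃ₗᵢ[ℝ] E) x) ((π k : E ≃ₗᵢ[ℝ] E) x))
      (inner ℝ ((g : E ≃ₗᵢ[ℝ] E) x) ((k : E ≃ₗᵢ[ℝ] E) w) +
        inner ℝ ((g : E ≃ₗᵢ[ℝ] E) w) ((k : E ≃ₗᵢ[ℝ] E) x) -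
        inner ℝ ((π g : E ≃ₗᵢ[ℝ] E) x) ((π k : E ≃ₗᵢ[ℝ] E) w) -
        inner ℝ ((π g : E ≃ₗᵢ[ℝ] E) w) ((π k : E ≃ₗᵢ[ℝ] E) x))
      (sub_ne_zero.2 hw)).subset fun t ht => ?_
    simp only [Set.mem_ofPred_eq, map_add, map_smul, inner_add_left, inner_add_right,
      real_inner_smul_left, real_inner_smul_right] at ht ⊢
    linear_combination ht
  have hsub : {v : E | IsGenericSeed H v}ᶜ ⊆
      {v : E | Submodule.span ℝ (Set.range fun h : H => (h : E ≃ₗᵢ[ℝ] E) v) = ⊤}ᶜ ∪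
      ((⋃ h : H, {v : E | (h : E ≃ₗᵢ[ℝ] E) ≠ 1 ∧ (h : E ≃ₗᵢ[ℝ] E) v = v}) ∪
      ⋃ (π : Equiv.Perm H), ⋃ (g : H), ⋃ (k : H), {v : E |
        (∃ w : E, inner ℝ ((g : E ≃ₗᵢ[ℝ] E) w) ((k : E ≃ₗᵢ[ℝ] E) w) ≠
          inner ℝ ((π g : E ≃ₗᵢ[ℝ] E) w) ((π k : E ≃ₗᵢ[ℝ] E) w)) ∧
        inner ℝ ((g : E ≃ₗᵢ[ℝ] E) v) ((k : E ≃ₗᵢ[ℝ] E) v) =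
          inner ℝ ((π g : E ≃ₗᵢ[ℝ] E) v) ((π k : E ≃ₗᵢ[ℝ] E) v)}) := by
    intro v hv
    by_contra h
    simp only [Set.mem_union, not_or, Set.mem_iUnion, not_exists, Set.mem_ofPred_eq, not_and,
      Set.mem_compl_iff, not_not] at h
    refine hv ⟨h.1, fun k hk hkv => ?_, fun π hπ w g k => ?_⟩
    · by_contra hne
      exact h.2.1 ⟨k, hk⟩ hne hkv
    · by_contra hne
      exact h.2.2 π g k ⟨w, hne⟩ (hπ g k)
  refine measure_mono_null hsub (measure_union_null (addHaar_setOf_span_orbit_ne_top μ hspan)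
    (measure_union_null ?_ ?_))
  · refine measure_iUnion_null fun h => ?_
    by_cases hh : (h : E ≃ₗᵢ[ℝ] E) = 1
    · simp [hh]
    · exact measure_mono_null (fun v hv => hv.2) (h2 h hh)
  · refine measure_iUnion_null fun π => measure_iUnion_null fun g => measure_iUnion_null fun k => ?_
    by_cases hw : ∃ w : E, inner ℝ ((g : E ≃ₗᵢ[ℝ] E) w) ((k : E ≃ₗᵢ[ℝ] E) w) ≠
          inner ℝ ((π g : E ≃ₗᵢ[ℝ] E) w) ((π k : E ≃ₗᵢ[ℝ] E) w)
    · obtain ⟨w, hw⟩ := hw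
      exact measure_mono_null (fun v hv => hv.2) (h3 π w g k hw)
    · simp [hw]

end LinearIsometryEquiv

/-! ### Exceptional configurations are closed and null -/

namespace LinearIsometryEquiv

open MeasureTheory

variable {E : Type*} [NormedAddCommGroup E] [InnerProductSpace ℝ E]
  {H : Subgroup (E ≃ₗᵢ[ℝ] E)} {ι : Type*} [Fintype ι]

/-- The point configurations `x` for which convex combinations of the classes of `f` form
an orbit (around some centre) of a point of `B`. -/
def orbitPartitionSet [DecidableEq H] (f : ι → H) (B : Set E) : Set (ι → E) :=
  {x | ∃ t : ι → ℝ, (∀ i, 0 ≤ t i) ∧ (∀ h, ∑ i with f i = h, t i = 1) ∧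
    ∃ c v : E, (∀ h : H, ∑ i with f i = h, t i • x i = c + (h : E ≃ₗᵢ[ℝ] E) v) ∧ v ∈ B}

theorem isClosed_orbitPartitionSet [Fintype H] [DecidableEq H]
    (hfix : ∀ w : E, (∀ h ∈ H, h w = w) → w = 0) (f : ι → H) {B : Set E} (hB : IsClosed B) :
    IsClosed (orbitPartitionSet f B) := by
  let K : Set (ι → ℝ) := {t | (∀ i, 0 ≤ t i) ∧ ∀ h, ∑ i with f i = h, t i = 1}
  have hKcl : IsClosed K := by
    simp only [K, Set.ofPred_and, Set.ofPred_forall]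
    refine IsClosed.inter ?_ ?_
    · exact isClosed_iInter fun i => isClosed_le continuous_const (continuous_apply i)
    · exact isClosed_iInter fun h => isClosed_eq (by fun_prop) continuous_const
  have hK : IsCompact K := by
    refine (isCompact_Icc (a := (0 : ι → ℝ)) (b := 1)).of_isClosed_subset hKcl fun t ht => ?_
    refine ⟨ht.1, fun i => ?_⟩
    rw [Pi.one_apply, ← ht.2 (f i)]
    exact Finset.single_le_sum (f := t) (fun k _ => ht.1 k) (by simp)
  have : CompactSpace K := isCompact_iff_compactSpace.1 hK
  let Y : H → (ι → E) × K → E := fun h z => ∑ i with f i = h, (z.2 : ι → ℝ) i • z.1 i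
  -- The centre is the centroid of the class combinations and the seed is `Y 1 - C`. Both depend
  -- continuously on points and weights, so the set is the projection of a closed set along a
  -- compact factor.
  let C : (ι → E) × K → E := fun z => (Fintype.card H : ℝ)⁻¹ • ∑ h, Y h z
  let Z : Set ((ι → E) × K) :=
    {z | Y 1 z - C z ∈ B ∧ ∀ h : H, Y h z = C z + (h : E ≃ₗᵢ[ℝ] E) (Y 1 z - C z)}
  have hY : ∀ h, Continuous (Y h) := fun h => by
    refine continuous_finsetSum _ fun i _ => ?_
    have h1 : Continuous fun z : (ι → E) × K => (z.2 : ι → ℝ) i :=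
      (continuous_apply i).comp (continuous_subtype_val.comp continuous_snd)
    have h2 : Continuous fun z : (ι → E) × K => z.1 i := (continuous_apply i).comp continuous_fst
    exact h1.smul h2
  have hC : Continuous C := (continuous_finsetSum _ fun h _ => hY h).const_smul _
  have hZ : IsClosed Z := by
    simp only [Z, Set.ofPred_and, Set.ofPred_forall]
    refine IsClosed.inter (hB.preimage ((hY 1).sub hC)) ?_
    exact isClosed_iInter fun h => isClosed_eq (hY h)
      (hC.add ((h : E ≃ₗᵢ[ℝ] E).continuous.comp ((hY 1).sub hC)))
  have heq : orbitPartitionSet f B = Prod.fst '' Z := by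
    ext x
    constructor
    · rintro ⟨t, ht0, ht1, c, v, hcv, hv⟩
      have hCc : C (x, ⟨t, ht0, ht1⟩) = c := by
        simp only [C, Y, hcv]
        exact centroid_orbit_eq hfix c v
      have hV : Y 1 (x, ⟨t, ht0, ht1⟩) - C (x, ⟨t, ht0, ht1⟩) = v := by
        rw [hCc]
        simp only [Y, hcv]
        simp
      refine ⟨(x, ⟨t, ht0, ht1⟩), ⟨?_, fun h => ?_⟩, rfl⟩
      · rw [hV]; exact hv
      · rw [hV, hCc]; exact hcv h
    · rintro ⟨⟨x, t⟩, ⟨hB, hh⟩, rfl⟩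
      exact ⟨t, t.2.1, t.2.2, _, _, hh, hB⟩
  rw [heq]
  exact isClosedMap_fst_of_compactSpace _ hZ

section Null

variable (f : ι → H) (j : H → ι)

/-- Given representatives `j` of the classes of `f`, the configuration whose weighted class
combinations form the orbit of `v` around `c`, in terms of its members other than the
representatives and of the ratios between their weights and those of the representatives. -/
noncomputable def orbitConfiguration [DecidableEq ι] [DecidableEq H]
    (u : ({i // ¬ i = j (f i)} → E) × ({i // ¬ i = j (f i)} → ℝ) × E × E) (i : ι) : E :=
  if hi : i = j (f i) then
    u.2.2.1 + (f i : E ≃ₗᵢ[ℝ] E) u.2.2.2 +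
      ∑ k, if hk : k = j (f k) then 0 else
        if f k = f i then
          u.2.1 ⟨k, hk⟩ • (u.2.2.1 + (f i : E ≃ₗᵢ[ℝ] E) u.2.2.2 - u.1 ⟨k, hk⟩) else 0
  else u.1 ⟨i, hi⟩

theorem differentiable_orbitConfiguration [DecidableEq ι] [DecidableEq H] :
    Differentiable ℝ (orbitConfiguration (E := E) f j) := by
  rw [differentiable_pi]
  intro i
  have hy : Differentiable ℝ fun u : ({i // ¬ i = j (f i)} → E) × ({i // ¬ i = j (f i)} → ℝ) × E × E
      => u.2.2.1 + (f i : E ≃ₗᵢ[ℝ] E) u.2.2.2 := by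
    have := (f i : E ≃ₗᵢ[ℝ] E).differentiable
    fun_prop
  unfold orbitConfiguration
  split_ifs with hi
  · refine hy.add (Differentiable.fun_sum fun k _ => ?_)
    split_ifs with hk hfk
    · exact differentiable_const _
    · have h1 : Differentiable ℝ fun u : ({i // ¬ i = j (f i)} → E) ×
          ({i // ¬ i = j (f i)} → ℝ) × E × E => u.2.1 ⟨k, hk⟩ := by fun_prop
      have h2 : Differentiable ℝ fun u : ({i // ¬ i = j (f i)} → E) ×
          ({i // ¬ i = j (f i)} → ℝ) × E × E => u.1 ⟨k, hk⟩ := by fun_prop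
      exact h1.smul (hy.sub h2)
    · exact differentiable_const _
  · fun_prop

/-- Each class has a member of nonzero weight. Solving for it gives `x_j = y + ∑ (t_k / t_j) (y -
x_k)` over the other members, with `y` the class combination. -/
theorem orbitPartitionSet_subset [DecidableEq ι] [DecidableEq H] (B : Set E) :
    orbitPartitionSet f B ⊆ ⋃ j : {j : H → ι // ∀ h, f (j h) = h},
      orbitConfiguration f j.1 '' {u | u.2.2.2 ∈ B} := by
  rintro x ⟨t, -, ht1, c, v, hcv, hv⟩
  have hj : ∀ h, ∃ i, f i = h ∧ t i ≠ 0 := by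
    intro h
    by_contra! h0
    have h1 : ∑ i with f i = h, t i = 0 := Finset.sum_eq_zero fun i hi => h0 i (by simpa using hi)
    rw [ht1] at h1
    exact one_ne_zero h1
  choose j hjf hjt using hj
  refine Set.mem_iUnion.2 ⟨⟨j, hjf⟩, ⟨fun i => x i, fun i => t i / t (j (f i)), c, v⟩, hv, ?_⟩
  ext1 i
  simp only [orbitConfiguration]
  split_ifs with hi
  swap
  · rfl
  set y := c + (f i : E ≃ₗᵢ[ℝ] E) v with hy
  have hzero : ∑ k, (if f k = f i then t k • (y - x k) else 0) = 0 := by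
    rw [← Finset.sum_filter]
    simp only [smul_sub, Finset.sum_sub_distrib]
    rw [hcv, ← Finset.sum_smul, ht1, one_smul, sub_self]
  have hti : t i ≠ 0 := by rw [hi]; exact hjt _
  refine smul_right_injective E hti ?_
  simp only
  rw [smul_add, Finset.smul_sum]
  have hterm : ∀ k, (t i • if k = j (f k) then (0 : E) else
      if f k = f i then (t k / t (j (f k))) • (y - x k) else 0) =
      (if f k = f i then t k • (y - x k) else 0) - if k = i then t i • (y - x i) else 0 := by
    intro k
    by_cases hki : k = i
    · subst hki
      simp [← hi]
    · by_cases hfk : f k = f i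
      · have hkj : k ≠ j (f k) := by rw [hfk, ← hi]; exact hki
        rw [if_neg hkj, if_pos hfk, if_pos hfk, if_neg hki, sub_zero, smul_smul, hfk, ← hi,
          mul_div_cancel₀ _ hti]
      · simp [hfk, hki]
  simp only [dite_eq_ite, hterm, Finset.sum_sub_distrib, hzero]
  simp [smul_sub]

theorem addHaar_orbitPartitionSet [FiniteDimensional ℝ E] [MeasurableSpace E] [BorelSpace E]
    [Fintype H] [DecidableEq H]
    (hcard : Fintype.card ι + 2 * Module.finrank ℝ E =
      Fintype.card H * (Module.finrank ℝ E + 1))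
    (μ : Measure (ι → E)) [μ.IsAddHaarMeasure] (ν : Measure E) [ν.IsAddHaarMeasure]
    {B : Set E} (hBm : MeasurableSet B) (hB : ν B = 0) :
    μ (orbitPartitionSet f B) = 0 := by
  classical
  refine measure_mono_null (orbitPartitionSet_subset f B) (measure_iUnion_null ?_)
  rintro ⟨j, hj⟩
  have hrep : Fintype.card {i // i = j (f i)} = Fintype.card H := by
    refine (Fintype.card_congr (Equiv.ofBijective
      (fun h => (⟨j h, by rw [hj]⟩ : {i // i = j (f i)})) ⟨fun h k hhk => ?_, ?_⟩)).symm
    · have h1 := congrArg (fun i => f i.1) hhk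
      simpa [hj] using h1
    · rintro ⟨i, hi⟩
      exact ⟨f i, Subtype.ext hi.symm⟩
  have hcompl := Fintype.card_subtype_compl fun i => i = j (f i)
  have hle := Fintype.card_subtype_le fun i => i = j (f i)
  -- With `n` points, `r = |H|` and `d = dim E`, the parameters number `(n - r)(d + 1) + 2d`, which
  -- is `nd` exactly by `hcard`.
  have hfin : Module.finrank ℝ (ι → E) = Module.finrank ℝ
      (({i // ¬ i = j (f i)} → E) × ({i // ¬ i = j (f i)} → ℝ) × E × E) := by
    rw [hrep] at hcompl hle
    simp only [Module.finrank_pi_fintype, Module.finrank_prod, Finset.sum_const, Finset.card_univ,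
      smul_eq_mul, Module.finrank_self, mul_one]
    obtain ⟨m, hm⟩ := Nat.exists_eq_add_of_le hle
    rw [hm, Nat.add_sub_cancel_left] at hcompl
    rw [hcompl, hm]
    rw [hm] at hcard
    nlinarith
  let e := ContinuousLinearEquiv.ofFinrankEq hfin
  let L : (ι → E) →ₗ[ℝ] E := LinearMap.snd ℝ E E ∘ₗ LinearMap.snd ℝ _ _ ∘ₗ LinearMap.snd ℝ _ _ ∘ₗ
    e.toLinearEquiv.toLinearMap
  have hL : Function.Surjective L := fun y => ⟨e.symm (0, 0, 0, y), by simp [L]⟩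
  have hnull : μ {x | L x ∈ B} = 0 := by
    have h1 := (ae_comp_linearMap_mem_iff L μ ν hL hBm.compl).2 (by
      rw [ae_iff]; simpa using hB)
    rw [ae_iff] at h1
    simpa using h1
  have himg : orbitConfiguration (E := E) f j '' {u | u.2.2.2 ∈ B} =
      (orbitConfiguration f j ∘ e) '' {x | L x ∈ B} := by
    ext x
    constructor
    · rintro ⟨u, hu, rfl⟩
      exact ⟨e.symm u, by simpa [L] using hu, by simp⟩
    · rintro ⟨z, hz, rfl⟩
      exact ⟨e z, hz, rfl⟩
  rw [himg]
  exact addHaar_image_eq_zero_of_differentiableOn_of_addHaar_eq_zero μ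
    ((differentiable_orbitConfiguration f j).comp e.differentiable).differentiableOn hnull

end Null

theorem isometryFixingHom_eq_conj_comp (c p : E) :
    isometryFixingHom c = (MulAut.conj (IsometryEquiv.addLeft (c - p))).toMonoidHom.comp
      (isometryFixingHom p) := by
  ext T x
  change _ = (c - p) + isometryFixingHom p T (-(c - p) + x)
  rw [isometryFixingHom_apply, isometryFixingHom_apply]
  rw [show -(c - p) + x - p = x - c by abel]
  abel

end LinearIsometryEquiv

/-! ### Assembling the theorem -/

theorem canBePartitioned_convexHull_orbit {d N : ℕ}
    {H : Subgroup (EuclideanSpace ℝ (Fin d) ≃ₗᵢ[ℝ] EuclideanSpace ℝ (Fin d))} [Finite H]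
    [DecidableEq H] {c v : EuclideanSpace ℝ (Fin d)} (hv : LinearIsometryEquiv.IsGenericSeed H v)
    {x : Fin N → EuclideanSpace ℝ (Fin d)} {f : Fin N → H} {t : Fin N → ℝ} (ht0 : ∀ i, 0 ≤ t i)
    (ht1 : ∀ h, ∑ i with f i = h, t i = 1)
    (hcv : ∀ h : H, ∑ i with f i = h, t i • x i =
      c + (h : EuclideanSpace ℝ (Fin d) ≃ₗᵢ[ℝ] EuclideanSpace ℝ (Fin d)) v) :
    CanBePartitioned (Nat.card H) (convexHull ℝ (Set.range fun h : H =>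
      c + (h : EuclideanSpace ℝ (Fin d) ≃ₗᵢ[ℝ] EuclideanSpace ℝ (Fin d)) v)) x := by
  let e : Fin (Nat.card H) ≃ H := (Finite.equivFin H).symm
  refine ⟨fun k => {i | f i = e k}, fun k l hkl => ?_, ?_, fun k =>
    c + (e k : EuclideanSpace ℝ (Fin d) ≃ₗᵢ[ℝ] EuclideanSpace ℝ (Fin d)) v, fun k => ?_,
    fun k l hkl => ?_, ?_⟩
  · refine Set.disjoint_left.2 fun i (hik : f i = e k) (hil : f i = e l) => hkl ?_
    exact e.injective (hik.symm.trans hil)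
  · exact Set.eq_univ_of_forall fun i => Set.mem_iUnion.2 ⟨e.symm (f i), by simp⟩
  · simp only [← hcv]
    refine (convex_convexHull ℝ _).sum_mem (fun i _ => ht0 i) (ht1 _) fun i hi => ?_
    exact subset_convexHull ℝ _ ⟨i, by simpa using hi, rfl⟩
  · exact e.injective (hv.injective_orbit (add_left_cancel hkl))
  · rw [LinearIsometryEquiv.extremePoints_convexHull_orbit]
    exact e.surjective.range_comp fun h : H =>
      c + (h : EuclideanSpace ℝ (Fin d) ≃ₗᵢ[ℝ] EuclideanSpace ℝ (Fin d)) v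

open LinearIsometryEquiv MeasureTheory in
theorem theorem1p4 (d : ℕ) (hd : 2 ≤ d)
    (G : Subgroup (EuclideanSpace ℝ (Fin d) ≃ᵢ EuclideanSpace ℝ (Fin d)))
    (hG : ∃ Q : Set (EuclideanSpace ℝ (Fin d)), IsVertexTransitivePolytope Q ∧ isoGroup Q = G) :
    HoldsForGeneric (d := d) (N := (Nat.card G - 2) * (d + 1) + 2) (fun x =>
      ∃ P : Set (EuclideanSpace ℝ (Fin d)),
        IsVertexTransitivePolytope P ∧
        EqUpToTranslation (isoGroup P) G ∧
        CanBePartitioned (Nat.card G) P x) := by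
  classical
  obtain ⟨Q, hQ, rfl⟩ := hG
  obtain ⟨H, p, v₀, _, hGH, hfix, hspan, hsymm⟩ := hQ.exists_linear_group
  have := Fintype.ofFinite H
  have hcardG : Nat.card (isoGroup Q) = Nat.card H := by
    rw [hGH]
    exact (Nat.card_congr (H.equivMapOfInjective _ (isometryFixingHom_injective p)).toEquiv).symm
  -- This keeps the natural subtraction in `N` from truncating; a trivial group would fix every
  -- vector.
  have hcardH : 2 ≤ Nat.card H := by
    by_contra! hlt
    have hsub : Subsingleton H := by
      rw [Nat.card_eq_fintype_card] at hlt
      exact Fintype.card_le_one_iff_subsingleton.1 (by omega)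
    have : Nontrivial (EuclideanSpace ℝ (Fin d)) :=
      Module.nontrivial_of_finrank_pos (R := ℝ) (by simp; omega)
    obtain ⟨w, hw⟩ := exists_ne (0 : EuclideanSpace ℝ (Fin d))
    refine hw (hfix w fun h hh => ?_)
    have h1 : (⟨h, hh⟩ : H) = 1 := Subsingleton.elim _ _
    rw [show h = 1 from congrArg Subtype.val h1]
    rfl
  rw [hcardG]
  set N := (Nat.card H - 2) * (d + 1) + 2 with hN
  have hcard : Fintype.card (Fin N) + 2 * Module.finrank ℝ (EuclideanSpace ℝ (Fin d)) =
      Fintype.card H * (Module.finrank ℝ (EuclideanSpace ℝ (Fin d)) + 1) := by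
    obtain ⟨m, hm⟩ := Nat.exists_eq_add_of_le hcardH
    rw [Fintype.card_fin, finrank_euclideanSpace_fin, ← Nat.card_eq_fintype_card, hN, hm,
      Nat.add_sub_cancel_left]
    ring
  set B := {v | IsGenericSeed H v}ᶜ with hB
  have hBcl : IsClosed B := isOpen_setOf_isGenericSeed.isClosed_compl
  have hnull : volume (⋃ f : Fin N → H, orbitPartitionSet f B) = 0 :=
    measure_iUnion_null fun f => addHaar_orbitPartitionSet f hcard volume volume
      hBcl.measurableSet (addHaar_setOf_not_isGenericSeed volume hspan)
  refine ⟨(⋃ f : Fin N → H, orbitPartitionSet f B)ᶜ,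
    (isClosed_iUnion_of_finite fun f => isClosed_orbitPartitionSet hfix f hBcl).isOpen_compl, ?_,
    by rwa [compl_compl], fun x hx => ?_⟩
  · exact Measure.dense_of_ae (μ := volume) (measure_eq_zero_iff_ae_notMem.1 hnull)
  obtain ⟨f, t, ht0, ht1, c, v, hcv⟩ := exists_partition_orbit H hfix (by omega) x
  have hv : IsGenericSeed H v := by
    by_contra hv
    exact hx (Set.mem_iUnion.2 ⟨f, t, ht0, ht1, c, v, hcv, hv⟩)
  -- The translation carries the centroid `p` of `Q` to the centroid `c` of the new polytope.
  refine ⟨_, isVertexTransitivePolytope_convexHull_orbit hfix c hv, ⟨c - p, ?_⟩,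
    canBePartitioned_convexHull_orbit hv ht0 ht1 hcv⟩
  rw [isoGroup_convexHull_orbit hfix hspan hsymm c hv, hGH, Subgroup.map_map,
    ← isometryFixingHom_eq_conj_comp]
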